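/- Let $\hat{\mathbb H}_2$ be the space of those points $Z$ of the Siegel upper half space of order $2$ (complex symmetric $2\times 2$ matrices with positive definite imaginary part) with $qZq^{-1}=Z$, where $q=\begin{pmatrix}0&1\\1&0\end{pmatrix}$; that is, $$\hat{\mathbb H}_2=\Big\{\begin{pmatrix}\tau&z\\z&\tau\end{pmatrix} : \tau,z\in\mathbb C,\ \operatorname{Im}\tau>|\operatorname{Im}z|\Big\}.$$ Equip it with the symplectic metric $ds^2=\operatorname{tr}(Y^{-1}dZ\,Y^{-1}d\bar Z)$, $Y=\operatorname{Im}Z$. A geodesic joining two points is a curve of shortest length among all piecewise continuously differentiable curves in $\hat{\mathbb H}_2$ joining them, and the distance of two points is the infimum of the lengths of these curves. Let $Z_1=\begin{pmatrix}\tau_1&z_1\\z_1&\tau_1\end{pmatrix}$ and $Z_2=\begin{pmatrix}\tau_2&z_2\\z_2&\tau_2\end{pmatrix}$ be any two points of $\hat{\mathbb H}_2$, and let $s_0$ be their distance. Write, with real $x_j,y_j,u_j,v_j$, $$\tau_1+z_1=x_1+iy_1,\quad \tau_1-z_1=x_2+iy_2,\quad \tau_2+z_2=u_1+iv_1,\quad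 \tau_2-z_2=u_2+iv_2,$$ $$A=\frac{y_1^2+v_1^2+(x_1-u_1)^2}{y_1v_1},\quad B=\frac{y_2^2+v_2^2+(x_2-u_2)^2}{y_2v_2},\quad \lambda=\frac{A+\sqrt{A^2-4}}2,\quad \tilde\lambda=\frac{B+\sqrt{B^2-4}}2 ,$$ and let $c(x)=(x^2-1)^{-1}$ for $x>1$ and $c(1)=1$. Then $A,B\ge 2$, $\lambda,\tilde\lambda\ge 1$, $s_0=\sqrt{\log^2\lambda+\log^2\tilde\lambda}$, and the geodesic joining $Z_1$ and $Z_2$ is $$W(s)=\begin{pmatrix}\tau(s)&z(s)\\z(s)&\tau(s)\end{pmatrix}\qquad(0\le s\le s_0),$$ where $$\tau(s)=\frac{x_1+x_2}2+\frac{y_1}2F(s)+\frac{y_2}2\tilde F(s),\qquad z(s)=\frac{x_1-x_2}2+\frac{y_1}2F(s)-\frac{y_2}2\tilde F(s),$$ $$F(s)=\frac{\lambda(u_1-x_1)(\lambda^{2s/s_0}-1)c(\lambda)+iv_1\lambda^{s/s_0}}{(\lambda y_1-v_1)(\lambda^{2s/s_0}-1)c(\lambda)+v_1},\qquad \tilde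 F(s)=\frac{\tilde\lambda(u_2-x_2)(\tilde\lambda^{2s/s_0}-1)c(\tilde\lambda)+iv_2\tilde\lambda^{s/s_0}}{(\tilde\lambda y_2-v_2)(\tilde\lambda^{2s/s_0}-1)c(\tilde\lambda)+v_2},$$ both denominators being positive (if $Z_1=Z_2$, then $s_0=0$, $\lambda=\tilde\lambda=1$, and the powers of $\lambda,\tilde\lambda$ are read as $1$). More precisely: $W$ is smooth on $[0,s_0]$, has values in $\hat{\mathbb H}_2$, satisfies $W(0)=Z_1$ and $W(s_0)=Z_2$, and is of shortest length among the piecewise continuously differentiable curves in $\hat{\mathbb H}_2$ from $Z_1$ to $Z_2$; for $0\le s\le s_0$ the arc of $W$ from $W(0)$ to $W(s)$ has length $s$; and $W$ satisfies the geodesic equation $\ddot W=-i\,\dot W(\operatorname{Im}W)^{-1}\dot W$ for $0<s<s_0$. The geodesic is uniquely determined by $Z_1$ and $Z_2$: if $\gamma:[a,b]\to\hat{\mathbb H}_2$ is any piecewise continuously differentiable curve of shortest length from $Z_1$ to $Z_2$, then $\gamma(t)=W(\ell(t))$ for all $t\in[a,b]$, where $\ell(t)$ is the length of the arc of $\gamma$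 from $\gamma(a)$ to $\gamma(t)$. -/

import Mathlib

open Set Matrix

noncomputable section

namespace SiegelHat

/-- Complex square matrices of order `2`. -/
abbrev Mat2 : Type := Matrix (Fin 2) (Fin 2) ℂ

/-- The entrywise imaginary part `Im Z`. -/
def imPart (Z : Mat2) : Matrix (Fin 2) (Fin 2) ℝ := Z.map Complex.im

/-- The Siegel upper half space of order `2`: symmetric complex matrices with positive definite
imaginary part. -/
def siegelH2 : Set Mat2 := {Z | Zᵀ = Z ∧ (imPart Z).PosDef}

/-- The fractional linear expression `M<Z> = (A Z + B) (C Z + D)⁻¹` for a real block matrix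
`M = (A B; C D)` of order `4`. -/
def moebius (M : Matrix (Fin 2 ⊕ Fin 2) (Fin 2 ⊕ Fin 2) ℝ) (Z : Mat2) : Mat2 :=
  (M.toBlocks₁₁.map Complex.ofReal * Z + M.toBlocks₁₂.map Complex.ofReal) *
    (M.toBlocks₂₁.map Complex.ofReal * Z + M.toBlocks₂₂.map Complex.ofReal)⁻¹

/-- The exchange matrix `q` of order `2`. -/
def q : Matrix (Fin 2) (Fin 2) ℝ := !![0, 1; 1, 0]

/-- The block matrix `Q = diag (q, q)` of order `4`. -/
def Q : Matrix (Fin 2 ⊕ Fin 2) (Fin 2 ⊕ Fin 2) ℝ := Matrix.fromBlocks q 0 0 q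

/-- The space `Ĥ₂` of those points of the Siegel upper half space that are fixed by `Q`. -/
def hatH2 : Set Mat2 := {Z | Z ∈ siegelH2 ∧ moebius Q Z = Z}

/-- The inverse `Y⁻¹` of `Y = Im Z`, as a complex matrix. -/
def imInv (Z : Mat2) : Mat2 := (imPart Z)⁻¹.map Complex.ofReal

/-- The symplectic metric `ds² = tr (Y⁻¹ dZ Y⁻¹ dZ̄)` at the point `Z`, evaluated at the tangent
vector `dZ = V`. -/
def metricSq (Z V : Mat2) : ℝ :=
  (Matrix.trace (imInv Z * V * imInv Z * V.map (starRingEnd ℂ))).re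

/-- The entrywise derivative of a matrix-valued function of a real variable. -/
def dot (γ : ℝ → Mat2) (t : ℝ) : Mat2 := Matrix.of fun i j => deriv (fun u => γ u i j) t

/-- The length of the arc of `γ` between the parameters `a` and `b`. -/
def arcLength (γ : ℝ → Mat2) (a b : ℝ) : ℝ :=
  ∫ t in a..b, Real.sqrt (metricSq (γ t) (dot γ t))

/-- `γ` is piecewise continuously differentiable on `[a, b]`: there is a finite subdivision of
`[a, b]` into closed intervals on each of which `γ` is of class `C¹`, up to the end points. -/
def PiecewiseC1 (γ : ℝ → Mat2) (a b : ℝ) : Prop :=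
  ∃ (n : ℕ) (t : ℕ → ℝ), Monotone t ∧ t 0 = a ∧ t n = b ∧
    ∀ k < n, ∀ i j, ContDiffOn ℝ 1 (fun u => γ u i j) (Icc (t k) (t (k + 1)))

/-- `γ`, restricted to `[a, b]`, is a piecewise `C¹` curve in `Ĥ₂` from `Z₁` to `Z₂`. -/
structure Joins (γ : ℝ → Mat2) (a b : ℝ) (Z₁ Z₂ : Mat2) : Prop where
  le : a ≤ b
  mem : ∀ t ∈ Icc a b, γ t ∈ hatH2
  smooth : PiecewiseC1 γ a b
  left : γ a = Z₁
  right : γ b = Z₂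

/-- `γ`, restricted to `[a, b]`, is a geodesic joining `Z₁` and `Z₂`: a curve of shortest length
among all piecewise `C¹` curves in `Ĥ₂` from `Z₁` to `Z₂`. -/
def IsGeodesic (γ : ℝ → Mat2) (a b : ℝ) (Z₁ Z₂ : Mat2) : Prop :=
  Joins γ a b Z₁ Z₂ ∧
    ∀ (γ' : ℝ → Mat2) (a' b' : ℝ), Joins γ' a' b' Z₁ Z₂ → arcLength γ a b ≤ arcLength γ' a' b'

/-- The symplectic distance of `Z₁` and `Z₂`: the infimum of the lengths of the curves in `Ĥ₂`
from `Z₁` to `Z₂`. -/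
def sympDist (Z₁ Z₂ : Mat2) : ℝ :=
  sInf {L | ∃ (γ : ℝ → Mat2) (a b : ℝ), Joins γ a b Z₁ Z₂ ∧ arcLength γ a b = L}

/-- The function `c` on `[1, ∞)`: `c x = (x² - 1)⁻¹` for `x > 1` and `c 1 = 1`. -/
def c (x : ℝ) : ℝ := if 1 < x then (x ^ 2 - 1)⁻¹ else 1

end SiegelHat

end

/-!
The eigenvalues `w₁ = τ + z` and `w₂ = τ - z` of `Z = (τ, z; z, τ)` belong to eigenvectors that do
not depend on `Z`. They identify `Ĥ₂` with the product of two upper half-planes, and the symplectic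
metric with `|dw₁|² / (Im w₁)² + |dw₂|² / (Im w₂)²` (`metricSq_ofEigen`), the product of two
hyperbolic metrics. So the distance ought to be `√(d₁² + d₂²)`, where `d₁ = log l` and
`d₂ = log l'` are the hyperbolic distances of the eigenvalues, and the geodesic ought to be a pair
of hyperbolic geodesics run through at constant speeds proportional to `d₁` and `d₂`.

*Lower bound.* The `ℓ²` product of two copies of Mathlib's metric space `ℍ` satisfies the triangle
inequality, and along a `C¹` arc the distance from the initial point grows at most with the speed of
the arc. Hence every arc is at least as long as the distance of its end points
(`dist_le_integral_of_contDiffOn`, `Joins.dist_le_arcLength`).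

*The geodesic.* In each half-plane the formula of the statement is, in terms of `p = exp (k s)`, a
real fractional linear image of `i p`. This shows in the relations `0 ≤ b ≤ v` and
`a² = b (v - b)` between its coefficients (`coeff_relations`), which are all that is needed to see
that its denominator is positive, that its speed is `k` and that it satisfies the geodesic equation.
So the curve has length `√(d₁² + d₂²)` and attains the lower bound.

*Uniqueness.* A point of a shortest curve satisfies equality in the triangle inequality of the
product. By the Cauchy-Schwarz inequality its components divide `d₁` and `d₂` in the same ratio
(`dist_components_of_between`), and a point of the hyperbolic plane that lies between two points is
determined by its distances from them (`eq_joinPoint_of_dist_eq`).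
-/

noncomputable section

namespace SiegelHat

open Filter Topology UpperHalfPlane MeasureTheory

/-! ### Points of `Ĥ₂` and tangent vectors through their eigenvalues -/

/-- The symmetric matrix `(τ, z; z, τ)` with eigenvalues `τ + z = w₁` and `τ - z = w₂`; its
eigenvectors `(1, 1)` and `(1, -1)` do not depend on `w₁` and `w₂`. -/
def ofEigen (w₁ w₂ : ℂ) : Mat2 :=
  !![(w₁ + w₂) / 2, (w₁ - w₂) / 2; (w₁ - w₂) / 2, (w₁ + w₂) / 2]

/-- The first eigenvalue `τ + z` of `(τ, z; z, τ)`. -/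
def eigen₁ (Z : Mat2) : ℂ := Z 0 0 + Z 0 1

/-- The second eigenvalue `τ - z` of `(τ, z; z, τ)`. -/
def eigen₂ (Z : Mat2) : ℂ := Z 0 0 - Z 0 1

@[simp] lemma eigen₁_ofEigen (w₁ w₂ : ℂ) : eigen₁ (ofEigen w₁ w₂) = w₁ := by
  simp [eigen₁, ofEigen]; ring

@[simp] lemma eigen₂_ofEigen (w₁ w₂ : ℂ) : eigen₂ (ofEigen w₁ w₂) = w₂ := by
  simp [eigen₂, ofEigen]; ring

lemma eq_ofEigen (τ z : ℂ) : !![τ, z; z, τ] = ofEigen (τ + z) (τ - z) := by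
  ext i j; fin_cases i <;> fin_cases j <;> simp [ofEigen]

lemma ofEigen_mul (w₁ w₂ w₁' w₂' : ℂ) :
    ofEigen w₁ w₂ * ofEigen w₁' w₂' = ofEigen (w₁ * w₁') (w₂ * w₂') := by
  ext i j
  fin_cases i <;> fin_cases j <;> simp [ofEigen, Matrix.mul_apply, Fin.sum_univ_two] <;> ring

lemma smul_ofEigen (a w₁ w₂ : ℂ) : a • ofEigen w₁ w₂ = ofEigen (a * w₁) (a * w₂) := by
  ext i j; fin_cases i <;> fin_cases j <;> simp [ofEigen] <;> ring

lemma trace_ofEigen (w₁ w₂ : ℂ) : (ofEigen w₁ w₂).trace = w₁ + w₂ := by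
  simp [ofEigen, Matrix.trace, Fin.sum_univ_two]

lemma ofEigen_map_conj (w₁ w₂ : ℂ) : (ofEigen w₁ w₂).map (starRingEnd ℂ) =
    ofEigen (starRingEnd ℂ w₁) (starRingEnd ℂ w₂) := by
  have h2 : starRingEnd ℂ 2 = 2 := Complex.conj_ofNat 2
  ext i j; fin_cases i <;> fin_cases j <;> simp [ofEigen, h2]

lemma imPart_ofEigen (w₁ w₂ : ℂ) : imPart (ofEigen w₁ w₂) =
    !![(w₁.im + w₂.im) / 2, (w₁.im - w₂.im) / 2; (w₁.im - w₂.im) / 2, (w₁.im + w₂.im) / 2] := by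
  ext i j; fin_cases i <;> fin_cases j <;> simp [imPart, ofEigen]

lemma imInv_ofEigen {w₁ w₂ : ℂ} (h₁ : w₁.im ≠ 0) (h₂ : w₂.im ≠ 0) :
    imInv (ofEigen w₁ w₂) = ofEigen (w₁.im : ℂ)⁻¹ (w₂.im : ℂ)⁻¹ := by
  have hinv : (imPart (ofEigen w₁ w₂))⁻¹ =
      !![(w₁.im⁻¹ + w₂.im⁻¹) / 2, (w₁.im⁻¹ - w₂.im⁻¹) / 2;
        (w₁.im⁻¹ - w₂.im⁻¹) / 2, (w₁.im⁻¹ + w₂.im⁻¹) / 2] := by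
    apply Matrix.inv_eq_right_inv
    rw [imPart_ofEigen]
    ext i j
    fin_cases i <;> fin_cases j <;> simp [Matrix.mul_apply, Fin.sum_univ_two] <;>
      field_simp <;> ring
  rw [imInv, hinv]
  ext i j; fin_cases i <;> fin_cases j <;> simp [ofEigen]

/-- On `Ĥ₂` the symplectic metric is the sum of the Poincaré metrics of the two eigenvalues. -/
lemma metricSq_ofEigen {w₁ w₂ : ℂ} (h₁ : w₁.im ≠ 0) (h₂ : w₂.im ≠ 0) (d₁ d₂ : ℂ) :
    metricSq (ofEigen w₁ w₂) (ofEigen d₁ d₂) =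
      (‖d₁‖ / w₁.im) ^ 2 + (‖d₂‖ / w₂.im) ^ 2 := by
  have key : ∀ (y : ℝ) (d : ℂ), (y : ℂ)⁻¹ * d * (y : ℂ)⁻¹ * starRingEnd ℂ d =
      (((‖d‖ / y) ^ 2 : ℝ) : ℂ) := by
    intro y d
    rw [show (y : ℂ)⁻¹ * d * (y : ℂ)⁻¹ * starRingEnd ℂ d
      = (y : ℂ)⁻¹ ^ 2 * (d * starRingEnd ℂ d) by ring, Complex.mul_conj, Complex.normSq_eq_norm_sq]
    push_cast
    ring
  rw [metricSq, imInv_ofEigen h₁ h₂, ofEigen_map_conj]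
  simp only [ofEigen_mul, trace_ofEigen, key]
  rw [← Complex.ofReal_add, Complex.ofReal_re]

lemma moebius_Q (Z : Mat2) : moebius Q Z = !![Z 1 1, Z 1 0; Z 0 1, Z 0 0] := by
  have hq : (q.map Complex.ofReal)⁻¹ = q.map Complex.ofReal := by
    apply Matrix.inv_eq_right_inv
    ext i j; fin_cases i <;> fin_cases j <;> simp [q, Matrix.mul_apply, Fin.sum_univ_two]
  have h0 : (0 : Matrix (Fin 2) (Fin 2) ℝ).map Complex.ofReal = 0 := by
    ext i j; simp
  simp only [moebius, Q, Matrix.toBlocks_fromBlocks₁₁, Matrix.toBlocks_fromBlocks₁₂,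
    Matrix.toBlocks_fromBlocks₂₁, Matrix.toBlocks_fromBlocks₂₂, h0, add_zero, zero_mul,
    zero_add, hq]
  ext i j; fin_cases i <;> fin_cases j <;> simp [q, Matrix.mul_apply, Fin.sum_univ_two]

lemma posDef_imPart_ofEigen {w₁ w₂ : ℂ} :
    (imPart (ofEigen w₁ w₂)).PosDef ↔ 0 < w₁.im ∧ 0 < w₂.im := by
  rw [imPart_ofEigen]
  constructor
  · intro h
    have h1 := h.dotProduct_mulVec_pos (x := ![1, 1]) (by simp)
    have h2 := h.dotProduct_mulVec_pos (x := ![1, -1]) (by simp)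
    simp [Matrix.mulVec, dotProduct, Fin.sum_univ_two] at h1 h2
    constructor <;> linarith
  · rintro ⟨h1, h2⟩
    refine Matrix.PosDef.of_dotProduct_mulVec_pos ?_ ?_
    · ext i j; fin_cases i <;> fin_cases j <;> simp
    · intro x hx
      have hx' : x 0 + x 1 ≠ 0 ∨ x 0 - x 1 ≠ 0 := by
        by_contra! hcon
        apply hx
        ext i; fin_cases i <;> simp <;> linarith [hcon.1, hcon.2]
      have : star x ⬝ᵥ (!![(w₁.im + w₂.im) / 2, (w₁.im - w₂.im) / 2;
          (w₁.im - w₂.im) / 2, (w₁.im + w₂.im) / 2] *ᵥ x) =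
          w₁.im * (x 0 + x 1) ^ 2 / 2 + w₂.im * (x 0 - x 1) ^ 2 / 2 := by
        simp [Matrix.mulVec, dotProduct, Fin.sum_univ_two]; ring
      rw [this]
      rcases hx' with hx' | hx'
      · have := pow_pos (abs_pos.mpr hx') 2
        rw [sq_abs] at this
        positivity
      · have := pow_pos (abs_pos.mpr hx') 2
        rw [sq_abs] at this
        positivity

lemma ofEigen_mem_hatH2 {w₁ w₂ : ℂ} : ofEigen w₁ w₂ ∈ hatH2 ↔ 0 < w₁.im ∧ 0 < w₂.im := by
  rw [← posDef_imPart_ofEigen]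
  refine ⟨fun h => h.1.2, fun h => ⟨⟨?_, h⟩, ?_⟩⟩
  · ext i j; fin_cases i <;> fin_cases j <;> simp [ofEigen]
  · rw [moebius_Q]; ext i j; fin_cases i <;> fin_cases j <;> simp [ofEigen]

lemma eq_ofEigen_of_mem {Z : Mat2} (hZ : Z ∈ hatH2) : Z = ofEigen (eigen₁ Z) (eigen₂ Z) := by
  have h := hZ.2
  rw [moebius_Q] at h
  have h00 : Z 1 1 = Z 0 0 := by simpa using congrFun (congrFun h 0) 0
  have h01 : Z 1 0 = Z 0 1 := by simpa using congrFun (congrFun h 0) 1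
  ext i j; fin_cases i <;> fin_cases j <;> simp [ofEigen, eigen₁, eigen₂, h00, h01]

lemma eigen_im_pos {Z : Mat2} (hZ : Z ∈ hatH2) : 0 < (eigen₁ Z).im ∧ 0 < (eigen₂ Z).im := by
  rw [eq_ofEigen_of_mem hZ] at hZ
  exact ofEigen_mem_hatH2.1 hZ

/-- The entrywise derivative of a curve with prescribed differentiable eigenvalues. -/
lemma dot_eq_ofEigen {γ : ℝ → Mat2} {w₁ w₂ : ℝ → ℂ} {t : ℝ} {d₁ d₂ : ℂ}
    (hγ : ∀ᶠ u in 𝓝 t, γ u = ofEigen (w₁ u) (w₂ u))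
    (h₁ : HasDerivAt w₁ d₁ t) (h₂ : HasDerivAt w₂ d₂ t) : dot γ t = ofEigen d₁ d₂ := by
  have hadd : HasDerivAt (fun u => (w₁ u + w₂ u) / 2) ((d₁ + d₂) / 2) t :=
    (h₁.add h₂).div_const 2
  have hsub : HasDerivAt (fun u => (w₁ u - w₂ u) / 2) ((d₁ - d₂) / 2) t :=
    (h₁.sub h₂).div_const 2
  ext i j
  have hij : (fun u => γ u i j) =ᶠ[𝓝 t] fun u => ofEigen (w₁ u) (w₂ u) i j :=
    hγ.mono fun u hu => congrFun (congrFun hu i) j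
  rw [dot, Matrix.of_apply, hij.deriv_eq]
  fin_cases i <;> fin_cases j
  · exact hadd.deriv
  · exact hsub.deriv
  · exact hsub.deriv
  · exact hadd.deriv

/-! ### The length of a curve bounds the distance of its end points -/

/-- The pair of eigenvalues of a point of `Ĥ₂` as a point of the Euclidean (`ℓ²`) product of two
hyperbolic planes. Off `Ĥ₂` the value is irrelevant. -/
def toPlanes (Z : Mat2) : WithLp 2 (ℍ × ℍ) :=
  WithLp.toLp 2 (ofComplex (eigen₁ Z), ofComplex (eigen₂ Z))

lemma dist_planes (P Q : WithLp 2 (ℍ × ℍ)) :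
    dist P Q = √(dist P.fst Q.fst ^ 2 + dist P.snd Q.snd ^ 2) := by
  rw [WithLp.prod_dist_eq_add (by norm_num)]
  simp [Real.sqrt_eq_rpow]

lemma continuousOn_ofComplex_comp {w : ℝ → ℂ} {s : Set ℝ} (hw : ContinuousOn w s)
    (hpos : ∀ t ∈ s, 0 < (w t).im) : ContinuousOn (fun t => ofComplex (w t)) s := fun t ht =>
  (contMDiffAt_ofComplex (n := 1) (hpos t ht)).continuousAt.comp_continuousWithinAt (hw t ht)

/-- The hyperbolic distance of two nearby points of a curve, divided by the increment of the
parameter, is asymptotically at most the hyperbolic speed of the curve. The upper bound `M` is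
introduced because it is the quantity whose limit is easily computed. -/
lemma exists_tendsto_dist_div_le {w : ℝ → ℂ} {x d : ℝ} {w' : ℂ} (hxd : x < d)
    (hw : HasDerivWithinAt w w' (Ioi x) x) (hpos : ∀ t ∈ Icc x d, 0 < (w t).im) :
    ∃ M : ℝ → ℝ, Tendsto M (𝓝[>] x) (𝓝 (‖w'‖ / (w x).im)) ∧
      ∀ᶠ t in 𝓝[>] x, dist (ofComplex (w x)) (ofComplex (w t)) / (t - x) ≤ M t := by
  have hx := hpos x ⟨le_rfl, hxd.le⟩
  refine ⟨fun t => ‖slope w x t‖ / √((w x).im * (w t).im), ?_, ?_⟩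
  · have hs := ((hasDerivWithinAt_iff_tendsto_slope' (notMem_Ioi.2 le_rfl)).1 hw).norm
    have him : Tendsto (fun t => √((w x).im * (w t).im)) (𝓝[>] x) (𝓝 ((w x).im)) := by
      have h0 : Tendsto (fun t => (w t).im) (𝓝[>] x) (𝓝 (w x).im) :=
        (Complex.continuous_im.tendsto _).comp hw.continuousWithinAt
      have := (h0.const_mul (w x).im).sqrt
      rwa [Real.sqrt_mul_self hx.le] at this
    exact hs.div him hx.ne'
  · filter_upwards [Ioc_mem_nhdsGT hxd] with t ht
    have htx : 0 < t - x := sub_pos.2 ht.1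
    have hle := dist_le_dist_coe_div_sqrt (ofComplex (w x)) (ofComplex (w t))
    rw [ofComplex_apply_of_im_pos hx, ofComplex_apply_of_im_pos (hpos t ⟨ht.1.le, ht.2⟩)] at hle ⊢
    rw [slope_def_module, norm_smul, Real.norm_eq_abs, abs_of_pos (inv_pos.2 htx),
      div_le_iff₀ htx]
    refine hle.trans (le_of_eq ?_)
    rw [dist_comm, dist_eq_norm]
    change ‖w t - w x‖ / √((w x).im * (w t).im) = _
    field_simp

/-- A `C¹` curve in a product of two half-planes is at least as long as the distance of its end
points: the distance from the initial point grows at most with the speed of the curve. -/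
lemma dist_le_integral_of_contDiffOn {w₁ w₂ : ℝ → ℂ} {c d : ℝ} (hcd : c ≤ d)
    (h₁ : ContDiffOn ℝ 1 w₁ (Icc c d)) (h₂ : ContDiffOn ℝ 1 w₂ (Icc c d))
    (hp₁ : ∀ t ∈ Icc c d, 0 < (w₁ t).im) (hp₂ : ∀ t ∈ Icc c d, 0 < (w₂ t).im) :
    IntervalIntegrable (fun t => √((‖derivWithin w₁ (Icc c d) t‖ / (w₁ t).im) ^ 2 +
      (‖derivWithin w₂ (Icc c d) t‖ / (w₂ t).im) ^ 2)) volume c d ∧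
    dist (WithLp.toLp 2 (ofComplex (w₁ c), ofComplex (w₂ c)))
      (WithLp.toLp 2 (ofComplex (w₁ d), ofComplex (w₂ d))) ≤
      ∫ t in c..d, √((‖derivWithin w₁ (Icc c d) t‖ / (w₁ t).im) ^ 2 +
        (‖derivWithin w₂ (Icc c d) t‖ / (w₂ t).im) ^ 2) := by
  rcases hcd.eq_or_lt with rfl | hlt
  · simp
  set v : ℝ → ℝ := fun t => √((‖derivWithin w₁ (Icc c d) t‖ / (w₁ t).im) ^ 2 +
    (‖derivWithin w₂ (Icc c d) t‖ / (w₂ t).im) ^ 2)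
  have hu := uniqueDiffOn_Icc hlt
  have hspeed : ∀ w : ℝ → ℂ, ContDiffOn ℝ 1 w (Icc c d) → (∀ t ∈ Icc c d, 0 < (w t).im) →
      ContinuousOn (fun t => ‖derivWithin w (Icc c d) t‖ / (w t).im) (Icc c d) := fun w hw hp =>
    (hw.continuousOn_derivWithin hu le_rfl).norm.div
      (Complex.continuous_im.comp_continuousOn hw.continuousOn) fun t ht => (hp t ht).ne'
  have hvc : ContinuousOn v (Icc c d) :=
    (((hspeed w₁ h₁ hp₁).pow 2).add ((hspeed w₂ h₂ hp₂).pow 2)).sqrt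
  refine ⟨hvc.intervalIntegrable_of_Icc hcd, ?_⟩
  -- a continuous extension of the speed to the line, whose primitive is differentiable everywhere
  set V : ℝ → ℝ := IccExtend hcd ((Icc c d).domRestrict v)
  have hV : Continuous V := (continuousOn_iff_continuous_domRestrict.1 hvc).Icc_extend'
  have hVv : ∀ t ∈ Icc c d, V t = v t := fun t ht => IccExtend_of_mem hcd _ ht
  have hint : ∫ t in c..d, v t = ∫ t in c..d, V t := by
    refine intervalIntegral.integral_congr_Ioo_of_le hcd fun t ht => ?_
    exact (hVv t (Ioo_subset_Icc_self ht)).symm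
  set P : ℝ → WithLp 2 (ℍ × ℍ) := fun t => WithLp.toLp 2 (ofComplex (w₁ t), ofComplex (w₂ t))
  rw [hint]
  have hdist : ContinuousOn (fun t => dist (P c) (P t)) (Icc c d) := by
    have e : (fun t => dist (P c) (P t)) = fun t =>
        √(dist (ofComplex (w₁ c)) (ofComplex (w₁ t)) ^ 2 +
          dist (ofComplex (w₂ c)) (ofComplex (w₂ t)) ^ 2) := by
      funext t; exact dist_planes _ _
    rw [e]
    exact ((((continuous_const.dist continuous_id).comp_continuousOn
      (continuousOn_ofComplex_comp h₁.continuousOn hp₁)).pow 2).add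
      (((continuous_const.dist continuous_id).comp_continuousOn
        (continuousOn_ofComplex_comp h₂.continuousOn hp₂)).pow 2)).sqrt
  have hB : ∀ x, HasDerivAt (fun u => ∫ t in c..u, V t) (V x) x := fun x =>
    intervalIntegral.integral_hasDerivAt_right (hV.intervalIntegrable _ _)
      hV.aestronglyMeasurable.stronglyMeasurableAtFilter hV.continuousAt
  refine image_le_of_liminf_slope_right_le_deriv_boundary hdist (by simp)
    (fun x _ => (hB x).continuousAt.continuousWithinAt) (fun x _ => (hB x).hasDerivWithinAt)
    ?_ (right_mem_Icc.2 hcd)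
  intro x hx r hr
  have hxI : x ∈ Icc c d := Ico_subset_Icc_self hx
  have hsub : ∀ t ∈ Icc x d, t ∈ Icc c d := fun t ht => ⟨hx.1.trans ht.1, ht.2⟩
  have hder : ∀ w : ℝ → ℂ, ContDiffOn ℝ 1 w (Icc c d) →
      HasDerivWithinAt w (derivWithin w (Icc c d) x) (Ioi x) x := fun w hw =>
    (hw.differentiableOn (by norm_num) x hxI).hasDerivWithinAt.mono_of_mem_nhdsWithin
      (Icc_mem_nhdsGT_of_mem hx)
  obtain ⟨M₁, hM₁, hle₁⟩ := exists_tendsto_dist_div_le hx.2 (hder w₁ h₁)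
    fun t ht => hp₁ t (hsub t ht)
  obtain ⟨M₂, hM₂, hle₂⟩ := exists_tendsto_dist_div_le hx.2 (hder w₂ h₂)
    fun t ht => hp₂ t (hsub t ht)
  have hlim := ((hM₁.pow 2).add (hM₂.pow 2)).sqrt
  rw [hVv x hxI] at hr
  refine Eventually.frequently ?_
  filter_upwards [hlim.eventually_lt_const hr, hle₁, hle₂, self_mem_nhdsWithin]
    with t ht ht₁ ht₂ hxt
  have hpos : 0 < t - x := sub_pos.2 hxt
  refine lt_of_le_of_lt ?_ ht
  rw [slope_def_field, div_le_iff₀ hpos]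
  calc dist (P c) (P t) - dist (P c) (P x) ≤ dist (P x) (P t) := by
        linarith [dist_triangle (P c) (P x) (P t)]
    _ ≤ √(M₁ t ^ 2 + M₂ t ^ 2) * (t - x) := by
        rw [dist_planes, ← Real.sqrt_sq hpos.le, ← Real.sqrt_mul (by positivity)]
        rw [div_le_iff₀ hpos] at ht₁ ht₂
        apply Real.sqrt_le_sqrt
        rw [add_mul, ← mul_pow, ← mul_pow]
        exact add_le_add (pow_le_pow_left₀ dist_nonneg ht₁ 2) (pow_le_pow_left₀ dist_nonneg ht₂ 2)

lemma contDiffOn_eigen {γ : ℝ → Mat2} {s : Set ℝ} {n : WithTop ℕ∞}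
    (h : ∀ i j, ContDiffOn ℝ n (fun u => γ u i j) s) :
    ContDiffOn ℝ n (fun u => eigen₁ (γ u)) s ∧ ContDiffOn ℝ n (fun u => eigen₂ (γ u)) s :=
  ⟨(h 0 0).add (h 0 1), (h 0 0).sub (h 0 1)⟩

/-- The speed of a `C¹` arc in `Ĥ₂`, off the end points, in terms of the eigenvalues. -/
lemma sqrt_metricSq_eq {γ : ℝ → Mat2} {c d : ℝ} (hmem : ∀ t ∈ Icc c d, γ t ∈ hatH2)
    (hγ : ∀ i j, ContDiffOn ℝ 1 (fun u => γ u i j) (Icc c d)) {t : ℝ} (ht : t ∈ Ioo c d) :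
    √((‖derivWithin (fun u => eigen₁ (γ u)) (Icc c d) t‖ / (eigen₁ (γ t)).im) ^ 2 +
      (‖derivWithin (fun u => eigen₂ (γ u)) (Icc c d) t‖ / (eigen₂ (γ t)).im) ^ 2) =
    √(metricSq (γ t) (dot γ t)) := by
  obtain ⟨h₁, h₂⟩ := contDiffOn_eigen hγ
  have hnhds : Icc c d ∈ 𝓝 t := Icc_mem_nhds ht.1 ht.2
  have htI := Ioo_subset_Icc_self ht
  have hpos := eigen_im_pos (hmem t htI)
  have hd₁ := (h₁.differentiableOn (by norm_num) t htI).hasDerivWithinAt.hasDerivAt hnhds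
  have hd₂ := (h₂.differentiableOn (by norm_num) t htI).hasDerivWithinAt.hasDerivAt hnhds
  rw [dot_eq_ofEigen (by filter_upwards [hnhds] with u hu using eq_ofEigen_of_mem (hmem u hu))
    hd₁ hd₂]
  conv_rhs => rw [eq_ofEigen_of_mem (hmem t htI)]
  rw [metricSq_ofEigen hpos.1.ne' hpos.2.ne']

lemma PiecewiseC1.intervalIntegrable_and_dist_le {γ : ℝ → Mat2} {a b : ℝ}
    (hγ : PiecewiseC1 γ a b) (hmem : ∀ t ∈ Icc a b, γ t ∈ hatH2) :
    IntervalIntegrable (fun t => √(metricSq (γ t) (dot γ t))) volume a b ∧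
      dist (toPlanes (γ a)) (toPlanes (γ b)) ≤ arcLength γ a b := by
  obtain ⟨n, t, hmono, rfl, rfl, hC⟩ := hγ
  have piece : ∀ k < n, IntervalIntegrable (fun u => √(metricSq (γ u) (dot γ u))) volume
      (t k) (t (k + 1)) ∧ dist (toPlanes (γ (t k))) (toPlanes (γ (t (k + 1)))) ≤
        ∫ u in t k..t (k + 1), √(metricSq (γ u) (dot γ u)) := by
    intro k hk
    have hle : t k ≤ t (k + 1) := hmono (Nat.le_succ k)
    have hsub : ∀ u ∈ Icc (t k) (t (k + 1)), γ u ∈ hatH2 := fun u hu =>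
      hmem u ⟨(hmono (Nat.zero_le k)).trans hu.1, hu.2.trans (hmono hk)⟩
    obtain ⟨h₁, h₂⟩ := contDiffOn_eigen (hC k hk)
    obtain ⟨hi, hd⟩ := dist_le_integral_of_contDiffOn hle h₁ h₂
      (fun u hu => (eigen_im_pos (hsub u hu)).1) (fun u hu => (eigen_im_pos (hsub u hu)).2)
    have heq : EqOn _ _ (Ioo (t k) (t (k + 1))) := fun u hu => sqrt_metricSq_eq hsub (hC k hk) hu
    exact ⟨hi.congr_uIoo (by rwa [uIoo_of_le hle]),
      hd.trans_eq (intervalIntegral.integral_congr_Ioo_of_le hle heq)⟩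
  refine ⟨IntervalIntegrable.trans_iterate fun k hk => (piece k hk).1, ?_⟩
  rw [arcLength, ← intervalIntegral.sum_integral_adjacent_intervals fun k hk => (piece k hk).1]
  exact dist_le_range_sum_of_dist_le (f := fun k => toPlanes (γ (t k))) n
    fun {k} hk => (piece k hk).2

/-- Cutting the subdivision points off at `s` restricts a piecewise `C¹` curve to both sides
of `s`. -/
lemma PiecewiseC1.split {γ : ℝ → Mat2} {a b s : ℝ} (hγ : PiecewiseC1 γ a b) (hs : s ∈ Icc a b) :
    PiecewiseC1 γ a s ∧ PiecewiseC1 γ s b := by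
  have single : ∀ (i j : Fin 2), ContDiffOn ℝ 1 (fun u => γ u i j) {s} := by
    rintro i j x rfl
    exact contDiffWithinAt_singleton
  obtain ⟨n, t, hmono, rfl, rfl, hC⟩ := hγ
  refine ⟨⟨n, fun k => min (t k) s, fun k l h => min_le_min_right s (hmono h),
    min_eq_left hs.1, min_eq_right hs.2, fun k hk i j => ?_⟩,
    ⟨n, fun k => max (t k) s, fun k l h => max_le_max_right s (hmono h),
    max_eq_right hs.1, max_eq_left hs.2, fun k hk i j => ?_⟩⟩
  · rcases le_total (t k) s with h | h
    · refine (hC k hk i j).mono (Icc_subset_Icc (min_eq_left h).ge (min_le_left _ _))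
    · have h' : s ≤ t (k + 1) := h.trans (hmono (Nat.le_succ k))
      simpa only [min_eq_right h, min_eq_right h', Icc_self] using single i j
  · rcases le_total s (t (k + 1)) with h | h
    · refine (hC k hk i j).mono (Icc_subset_Icc (le_max_left _ _) (max_eq_left h).le)
    · have h' : t k ≤ s := (hmono (Nat.le_succ k)).trans h
      simpa only [max_eq_right h, max_eq_right h', Icc_self] using single i j

/-- Every arc of a curve in `Ĥ₂` is at least as long as the distance of its end points, and lengths
of arcs add up. -/
lemma Joins.dist_le_arcLength {γ : ℝ → Mat2} {a b s : ℝ} {Z₁ Z₂ : Mat2} (hγ : Joins γ a b Z₁ Z₂)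
    (hs : s ∈ Icc a b) :
    dist (toPlanes Z₁) (toPlanes (γ s)) ≤ arcLength γ a s ∧
    dist (toPlanes (γ s)) (toPlanes Z₂) ≤ arcLength γ s b ∧
    arcLength γ a s + arcLength γ s b = arcLength γ a b := by
  obtain ⟨hl, hr⟩ := hγ.smooth.split hs
  obtain ⟨il, dl⟩ := hl.intervalIntegrable_and_dist_le
    fun t ht => hγ.mem t ⟨ht.1, ht.2.trans hs.2⟩
  obtain ⟨ir, dr⟩ := hr.intervalIntegrable_and_dist_le
    fun t ht => hγ.mem t ⟨hs.1.trans ht.1, ht.2⟩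
  rw [hγ.left] at dl
  rw [hγ.right] at dr
  exact ⟨dl, dr, intervalIntegral.integral_add_adjacent_intervals il ir⟩

/-! ### Geodesics of the hyperbolic plane -/

/-- The point with parameter `p > 0` of the geodesic of the half-plane that starts, for `p = 1`, at
`x + i y`; the direction is determined by `a`, `b`, `v`, which are subject to `a² = b (v - b)`.
Under this condition it is the image of `i p` under a real fractional linear transformation. -/
def geodesicPoint (x y v a b p : ℝ) : ℂ :=
  x + y * ((((a * (p ^ 2 - 1) : ℝ) : ℂ) + Complex.I * ((v * p : ℝ) : ℂ)) /
    ((b * (p ^ 2 - 1) + v : ℝ) : ℂ))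

lemma geodesicPoint_re (x y v a b p : ℝ) :
    (geodesicPoint x y v a b p).re = x + y * (a * (p ^ 2 - 1)) / (b * (p ^ 2 - 1) + v) := by
  rw [geodesicPoint, Complex.add_re, Complex.ofReal_re, Complex.re_ofReal_mul,
    Complex.div_ofReal_re]
  simp [-Complex.ofReal_mul, -Complex.ofReal_sub, -Complex.ofReal_pow]
  ring

lemma geodesicPoint_im (x y v a b p : ℝ) :
    (geodesicPoint x y v a b p).im = y * (v * p) / (b * (p ^ 2 - 1) + v) := by
  rw [geodesicPoint, Complex.add_im, Complex.ofReal_im, Complex.im_ofReal_mul,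
    Complex.div_ofReal_im]
  simp [-Complex.ofReal_mul, -Complex.ofReal_sub, -Complex.ofReal_pow]
  ring

lemma geodesic_den_pos {v b p : ℝ} (hv : 0 < v) (hb : 0 ≤ b) (hbv : b ≤ v) (hp : 0 < p) :
    0 < b * (p ^ 2 - 1) + v := by
  rcases hb.eq_or_lt with rfl | hb
  · simpa using hv
  · nlinarith [mul_pos hb (pow_pos hp 2)]

lemma geodesicPoint_im_pos (x : ℝ) {y v b p : ℝ} (a : ℝ) (hy : 0 < y) (hv : 0 < v) (hb : 0 ≤ b)
    (hbv : b ≤ v) (hp : 0 < p) : 0 < (geodesicPoint x y v a b p).im := by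
  have := geodesic_den_pos hv hb hbv hp
  rw [geodesicPoint_im]
  positivity

/-- The derivative of `geodesicPoint x y v a b p` when `p` is a function with derivative `k p`. -/
def geodesicVelocity (y v a b k p : ℝ) : ℂ :=
  ((y * k * p * v / (b * (p ^ 2 - 1) + v) ^ 2 : ℝ) : ℂ) *
    (((2 * a * p : ℝ) : ℂ) + Complex.I * ((v - b - b * p ^ 2 : ℝ) : ℂ))

lemma hasDerivAt_geodesicPoint {p : ℝ → ℝ} {k s : ℝ} (hp : HasDerivAt p (k * p s) s)
    (x y a : ℝ) {v b : ℝ} (hD : b * (p s ^ 2 - 1) + v ≠ 0) :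
    HasDerivAt (fun s => geodesicPoint x y v a b (p s)) (geodesicVelocity y v a b k (p s)) s := by
  have hp2 : HasDerivAt (fun t => p t ^ 2) (2 * k * p s ^ 2) s :=
    (hp.fun_pow 2).congr_deriv (by push_cast; ring)
  have hN := (((hp2.sub_const 1).const_mul a).ofReal_comp).fun_add
    (((hp.const_mul v).ofReal_comp).const_mul Complex.I)
  have hD' := (((hp2.sub_const 1).const_mul b).add_const v).ofReal_comp
  have hD0 : ((b * (p s ^ 2 - 1) + v : ℝ) : ℂ) ≠ 0 := Complex.ofReal_ne_zero.2 hD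
  refine (((hN.fun_div hD' hD0).const_mul (y : ℂ)).const_add (x : ℂ)).congr_deriv ?_
  rw [geodesicVelocity]
  push_cast at hD0 ⊢
  field_simp
  ring

lemma norm_geodesicVelocity_div {x y v a b k p : ℝ} (hy : 0 < y) (hv : 0 < v) (hb : 0 ≤ b)
    (hbv : b ≤ v) (hab : a ^ 2 = b * (v - b)) (hk : 0 ≤ k) (hp : 0 < p) :
    ‖geodesicVelocity y v a b k p‖ / (geodesicPoint x y v a b p).im = k := by
  have hD := geodesic_den_pos hv hb hbv hp
  have hn : ‖((2 * a * p : ℝ) : ℂ) + Complex.I * ((v - b - b * p ^ 2 : ℝ) : ℂ)‖ =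
      b * (p ^ 2 - 1) + v := by
    rw [mul_comm Complex.I, Complex.norm_add_mul_I,
      show (2 * a * p) ^ 2 + (v - b - b * p ^ 2) ^ 2 = (b * (p ^ 2 - 1) + v) ^ 2 by
        linear_combination 4 * p ^ 2 * hab, Real.sqrt_sq hD.le]
  rw [geodesicVelocity, norm_mul, hn, Complex.norm_real, Real.norm_eq_abs,
    abs_of_nonneg (by positivity), geodesicPoint_im]
  field_simp

/-- The geodesic equation `w'' = -i w'² / Im w` of the half-plane. -/
lemma hasDerivAt_geodesicVelocity {p : ℝ → ℝ} {k s : ℝ} (hp : HasDerivAt p (k * p s) s)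
    (x : ℝ) {y v a b : ℝ} (hy : y ≠ 0) (hv : v ≠ 0) (hp0 : p s ≠ 0)
    (hD : b * (p s ^ 2 - 1) + v ≠ 0) (hab : a ^ 2 = b * (v - b)) :
    HasDerivAt (fun s => geodesicVelocity y v a b k (p s))
      (-Complex.I * (geodesicVelocity y v a b k (p s) *
        ((geodesicPoint x y v a b (p s)).im : ℂ)⁻¹ * geodesicVelocity y v a b k (p s))) s := by
  have hp2 : HasDerivAt (fun t => p t ^ 2) (2 * k * p s ^ 2) s :=
    (hp.fun_pow 2).congr_deriv (by push_cast; ring)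
  have hDsq := (((hp2.sub_const 1).const_mul b).add_const v).fun_pow 2
  have hc := (((hp.const_mul (y * k)).mul_const v).fun_div hDsq (pow_ne_zero 2 hD)).ofReal_comp
  have hV := ((hp.const_mul (2 * a)).ofReal_comp).fun_add
    (((hp2.const_mul b).const_sub (v - b)).ofReal_comp.const_mul Complex.I)
  refine (hc.fun_mul hV).congr_deriv ?_
  rw [geodesicPoint_im]
  simp only [geodesicVelocity]
  generalize p s = P at hp0 hD
  have hab' : (a : ℂ) ^ 2 = b * (v - b) := by exact_mod_cast hab
  have hP' : (P : ℂ) ≠ 0 := Complex.ofReal_ne_zero.2 hp0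
  have hy' : (y : ℂ) ≠ 0 := Complex.ofReal_ne_zero.2 hy
  have hv' : (v : ℂ) ≠ 0 := Complex.ofReal_ne_zero.2 hv
  have hD' : (b * (P ^ 2 - 1) + v : ℂ) ≠ 0 := by exact_mod_cast hD
  -- the identity to which the equation reduces after clearing denominators
  have key : ((2 * a * P + Complex.I * (v - b - b * P ^ 2)) +
      P * (2 * a - 2 * Complex.I * b * P)) * (b * (P ^ 2 - 1) + v) -
      4 * b * P ^ 2 * (2 * a * P + Complex.I * (v - b - b * P ^ 2)) =
      -Complex.I * (2 * a * P + Complex.I * (v - b - b * P ^ 2)) ^ 2 := by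
    linear_combination 4 * (P : ℂ) ^ 2 * Complex.I * hab' + (4 * a * P * (v - b - b * P ^ 2) +
      Complex.I * (v - b - b * P ^ 2) ^ 2) * Complex.I_sq
  push_cast
  generalize hDeq : (b * (P ^ 2 - 1) + v : ℂ) = D at hD' key ⊢
  field_simp
  linear_combination (k : ℂ) ^ 2 * key

/-! ### The geodesic joining two points -/

lemma two_le_of_eq {x y u v A : ℝ} (hy : 0 < y) (hv : 0 < v)
    (hA : A = (y ^ 2 + v ^ 2 + (x - u) ^ 2) / (y * v)) : 2 ≤ A := by
  rw [hA, le_div_iff₀ (by positivity)]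
  nlinarith [sq_nonneg (y - v), sq_nonneg (x - u)]

/-- `l = (A + √(A² - 4)) / 2` is the larger root of `l + l⁻¹ = A`. -/
lemma one_le_and_add_inv_eq {A l : ℝ} (hA : 2 ≤ A) (hl : l = (A + √(A ^ 2 - 4)) / 2) :
    1 ≤ l ∧ l + l⁻¹ = A := by
  have h0 : 0 ≤ A ^ 2 - 4 := by nlinarith
  have hs := Real.sq_sqrt h0
  have hs0 := Real.sqrt_nonneg (A ^ 2 - 4)
  have hl1 : 1 ≤ l := by rw [hl]; linarith
  refine ⟨hl1, ?_⟩
  field_simp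
  rw [hl]
  linear_combination hs / 4

/-- The relations between the coefficients of the geodesic from `x + i y` to `u + i v` whose end
points have distance `log l`. -/
lemma coeff_relations {x y u v l : ℝ} (hy : 0 < y) (hv : 0 < v) (hl : 1 ≤ l)
    (h : l + l⁻¹ = (y ^ 2 + v ^ 2 + (x - u) ^ 2) / (y * v)) :
    0 ≤ (l * y - v) * c l ∧ (l * y - v) * c l ≤ v ∧
      (l * (u - x) * c l) ^ 2 = (l * y - v) * c l * (v - (l * y - v) * c l) := by
  have hl0 : 0 < l := by linarith
  have e : (l ^ 2 + 1) * (y * v) = l * (y ^ 2 + v ^ 2 + (x - u) ^ 2) := by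
    field_simp at h
    linear_combination h
  -- `l y - v` and `l v - y` have a nonnegative product and a nonnegative sum
  have hprod : (l * y - v) * (l * v - y) = l * (x - u) ^ 2 := by linear_combination e
  have hprod0 : 0 ≤ (l * y - v) * (l * v - y) := by rw [hprod]; positivity
  have hsum : 0 ≤ (l * y - v) + (l * v - y) := by nlinarith
  have h1 : 0 ≤ l * y - v := by
    by_contra! hneg
    have : 0 < l * v - y := by linarith
    nlinarith
  have h2 : 0 ≤ l * v - y := by
    by_contra! hneg
    have : 0 < l * y - v := by linarith
    nlinarith
  rcases hl.eq_or_lt with rfl | hlt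
  · have hyv : y = v := by linarith
    have hxu : (x - u) ^ 2 = 0 := by subst hyv; linarith
    have hxu' : x = u := by linarith [pow_eq_zero_iff (two_ne_zero) |>.1 hxu]
    subst hyv hxu'
    simp [c, hy.le]
  · have hl2 : 0 < l ^ 2 - 1 := by nlinarith
    rw [c, if_pos hlt]
    have hb : v - (l * y - v) * (l ^ 2 - 1)⁻¹ = l * (l * v - y) * (l ^ 2 - 1)⁻¹ := by
      field_simp
      ring
    refine ⟨by positivity, ?_, ?_⟩
    · have : 0 ≤ l * (l * v - y) * (l ^ 2 - 1)⁻¹ := by positivity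
      linarith
    · rw [hb]
      linear_combination (-(l * (l ^ 2 - 1)⁻¹ ^ 2)) * hprod

/-- The geodesic from `x + i y` to `u + i v` at the parameter `p ∈ [1, l]`, where `log l` is the
hyperbolic distance of the two points. -/
def joinPoint (x y u v l p : ℝ) : ℂ :=
  geodesicPoint x y v (l * (u - x) * c l) ((l * y - v) * c l) p

lemma joinPoint_one {v : ℝ} (x y u l : ℝ) (hv : v ≠ 0) :
    joinPoint x y u v l 1 = x + Complex.I * y := by
  have : (v : ℂ) ≠ 0 := Complex.ofReal_ne_zero.2 hv
  simp [joinPoint, geodesicPoint]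
  field_simp

lemma eq_of_one {x y u v : ℝ} (hy : 0 < y) (hv : 0 < v)
    (h : (1 : ℝ) + 1⁻¹ = (y ^ 2 + v ^ 2 + (x - u) ^ 2) / (y * v)) : x = u ∧ y = v := by
  field_simp at h
  constructor <;> nlinarith [sq_nonneg (x - u), sq_nonneg (y - v)]

lemma joinPoint_self {x y u v l : ℝ} (hy : 0 < y) (hv : 0 < v) (hl : 1 ≤ l)
    (h : l + l⁻¹ = (y ^ 2 + v ^ 2 + (x - u) ^ 2) / (y * v)) :
    joinPoint x y u v l l = u + Complex.I * v := by
  rcases hl.eq_or_lt with rfl | hlt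
  · obtain ⟨rfl, rfl⟩ := eq_of_one hy hv h
    exact joinPoint_one x y x 1 hy.ne'
  · have hl2 : (l ^ 2 - 1 : ℝ) ≠ 0 := by nlinarith
    have hl0 : l ≠ 0 := by linarith
    have hc : c l * (l ^ 2 - 1) = 1 := by rw [c, if_pos hlt]; field_simp
    have hden : (l * y - v) * c l * (l ^ 2 - 1) + v = l * y := by
      linear_combination (l * y - v) * hc
    have hnum : l * (u - x) * c l * (l ^ 2 - 1) = l * (u - x) := by
      linear_combination l * (u - x) * hc
    have hy' : (y : ℂ) ≠ 0 := Complex.ofReal_ne_zero.2 hy.ne'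
    have hl' : (l : ℂ) ≠ 0 := Complex.ofReal_ne_zero.2 hl0
    rw [joinPoint, geodesicPoint, hden, hnum]
    push_cast
    field_simp
    ring

lemma dist_eq_log {z w : ℍ} {l : ℝ} (hl : 1 ≤ l)
    (h : l + l⁻¹ = (z.im ^ 2 + w.im ^ 2 + (z.re - w.re) ^ 2) / (z.im * w.im)) :
    dist z w = Real.log l := by
  have hcosh : Real.cosh (dist z w) = Real.cosh (Real.log l) := by
    rw [Real.cosh_log (by linarith), h, cosh_dist']
    have := z.im_pos
    have := w.im_pos
    field_simp
    ring
  have h₁ := Real.cosh_le_cosh.1 hcosh.le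
  have h₂ := Real.cosh_le_cosh.1 hcosh.ge
  rw [abs_of_nonneg dist_nonneg, abs_of_nonneg (Real.log_nonneg hl)] at h₁ h₂
  exact le_antisymm h₁ h₂

/-- A point of the half-plane whose distances from the end points of a geodesic are those of a
point of the geodesic coincides with that point.

In the hyperboloid model, where `2 cosh (dist z w)` is a bilinear form, a point `G` of the geodesic
is a linear combination `α z + β w` of the end points. Hence `cosh (dist P G)` depends only on the
distances of `P` from `z` and `w`, and it has the same value as for `P = G`. -/
lemma eq_joinPoint_of_dist_eq {x y u v l p : ℝ} (hy : 0 < y) (hv : 0 < v) (hl : 1 ≤ l)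
    (hp : 0 < p) (h : l + l⁻¹ = (y ^ 2 + v ^ 2 + (x - u) ^ 2) / (y * v)) {X Y : ℝ}
    (h₁ : Y ^ 2 + y ^ 2 + (X - x) ^ 2 = Y * y * (p + p⁻¹))
    (h₂ : Y ^ 2 + v ^ 2 + (X - u) ^ 2 = Y * v * (l / p + p / l)) (hp1 : l = 1 → p = 1) :
    (X : ℂ) + Complex.I * Y = joinPoint x y u v l p := by
  rcases hl.eq_or_lt with rfl | hlt
  · obtain ⟨rfl, rfl⟩ := eq_of_one hy hv h
    have hp1 := hp1 rfl
    subst hp1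
    rw [joinPoint_one x y x 1 hy.ne']
    norm_num at h₁
    have hXx : X = x := by nlinarith [sq_nonneg (X - x), sq_nonneg (Y - y)]
    have hYy : Y = y := by nlinarith [sq_nonneg (X - x), sq_nonneg (Y - y)]
    rw [hXx, hYy]
  obtain ⟨hb, hbv, -⟩ := coeff_relations hy hv hl h
  have hl0 : 0 < l := by linarith
  have hl2 : 0 < l ^ 2 - 1 := by nlinarith
  have hD := geodesic_den_pos hv hb hbv hp
  have hre := geodesicPoint_re x y v (l * (u - x) * c l) ((l * y - v) * c l) p
  have him := geodesicPoint_im x y v (l * (u - x) * c l) ((l * y - v) * c l) p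
  set G := geodesicPoint x y v (l * (u - x) * c l) ((l * y - v) * c l) p
  have hGpos : 0 < G.im := geodesicPoint_im_pos x _ hy hv hb hbv hp
  set D := (l * y - v) * c l * (p ^ 2 - 1) + v with hDdef
  have hc : c l = (l ^ 2 - 1)⁻¹ := if_pos hlt
  -- the coefficients of `G` as a linear combination of the end points
  set α := (l ^ 2 / p - p) * c l with hα
  set β := l * (p - p⁻¹) * c l with hβ
  have g2 : 1 / G.im = α / y + β / v := by
    rw [him, hDdef, hα, hβ, hc]
    field_simp
    ring
  have g1 : G.re / G.im = α * x / y + β * u / v := by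
    have : G.re / G.im = x * (1 / G.im) + (l * (u - x) * c l) * (p ^ 2 - 1) / (v * p) := by
      rw [hre, him]
      field_simp
    rw [this, g2, hα, hβ, hc]
    field_simp
    ring
  have q1 : α ^ 2 + β ^ 2 + α * β * (l + l⁻¹) = 1 := by
    rw [hα, hβ, hc]
    field_simp
    ring
  have q2 : α * (p + p⁻¹) + β * (l / p + p / l) = 2 := by
    rw [hα, hβ, hc]
    field_simp
    ring
  set R := α * (x ^ 2 + y ^ 2) / y + β * (u ^ 2 + v ^ 2) / v with hR
  have g3 : G.re ^ 2 + G.im ^ 2 = R * G.im := by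
    have hRS : R * (1 / G.im) - (G.re / G.im) ^ 2 = 1 := by
      rw [g1, g2, ← q1, h, hR]
      field_simp
      ring
    field_simp at hRS
    linear_combination -hRS
  have g4 : (X ^ 2 + Y ^ 2) * (1 / G.im) - 2 * X * (G.re / G.im) + R = 2 * Y := by
    have e₁ : (X ^ 2 + Y ^ 2 - 2 * X * x + (x ^ 2 + y ^ 2)) / y = Y * (p + p⁻¹) := by
      rw [div_eq_iff hy.ne']
      linear_combination h₁
    have e₂ : (X ^ 2 + Y ^ 2 - 2 * X * u + (u ^ 2 + v ^ 2)) / v = Y * (l / p + p / l) := by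
      rw [div_eq_iff hv.ne']
      linear_combination h₂
    rw [g1, g2, hR]
    linear_combination α * e₁ + β * e₂ + Y * q2
  have g5 : X ^ 2 + Y ^ 2 - 2 * X * G.re + R * G.im = 2 * Y * G.im := by
    field_simp at g4
    linear_combination g4
  have hz : (X - G.re) ^ 2 + (Y - G.im) ^ 2 = 0 := by linear_combination g5 + g3
  have hre' : X = G.re := sub_eq_zero.1 (pow_eq_zero_iff two_ne_zero |>.1 <|
    le_antisymm (by linarith [sq_nonneg (Y - G.im)]) (sq_nonneg _))
  have him' : Y = G.im := sub_eq_zero.1 (pow_eq_zero_iff two_ne_zero |>.1 <|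
    le_antisymm (by linarith [sq_nonneg (X - G.re)]) (sq_nonneg _))
  apply Complex.ext
  · simpa [joinPoint] using hre'
  · simpa [joinPoint] using him'

/-- The number `l ≥ 1` is the exponential of the hyperbolic distance of the points `x + i y` and
`u + i v` of the half-plane: `2 cosh (log l) = l + l⁻¹`. -/
structure IsExpDist (x y u v l : ℝ) : Prop where
  y_pos : 0 < y
  v_pos : 0 < v
  one_le : 1 ≤ l
  add_inv : l + l⁻¹ = (y ^ 2 + v ^ 2 + (x - u) ^ 2) / (y * v)

/-- The curve `g` in the half-plane with velocity `g'` satisfies the geodesic equation and has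
constant speed `k`. -/
structure IsHalfPlaneGeodesic (g g' : ℝ → ℂ) (k : ℝ) : Prop where
  im_pos : ∀ s, 0 < (g s).im
  hasDerivAt : ∀ s, HasDerivAt g (g' s) s
  speed : ∀ s, ‖g' s‖ / (g s).im = k
  hasDerivAt_velocity : ∀ s,
    HasDerivAt g' (-Complex.I * (g' s * ((g s).im : ℂ)⁻¹ * g' s)) s

lemma hasDerivAt_exp_mul (k s : ℝ) :
    HasDerivAt (fun s => Real.exp (k * s)) (k * Real.exp (k * s)) s := by
  simpa [mul_comm] using ((hasDerivAt_id s).const_mul k).exp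

namespace IsExpDist

variable {x y u v l : ℝ}

lemma isHalfPlaneGeodesic (h : IsExpDist x y u v l) {k : ℝ} (hk : 0 ≤ k) :
    IsHalfPlaneGeodesic (fun s => joinPoint x y u v l (Real.exp (k * s)))
      (fun s => geodesicVelocity y v (l * (u - x) * c l) ((l * y - v) * c l) k
        (Real.exp (k * s))) k := by
  obtain ⟨hb, hbv, hab⟩ := coeff_relations h.y_pos h.v_pos h.one_le h.add_inv
  have hD : ∀ s, _ := fun s : ℝ => geodesic_den_pos h.v_pos hb hbv (Real.exp_pos (k * s))
  exact ⟨fun s => geodesicPoint_im_pos x _ h.y_pos h.v_pos hb hbv (Real.exp_pos _),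
    fun s => hasDerivAt_geodesicPoint (p := fun s => Real.exp (k * s)) (hasDerivAt_exp_mul k s)
      x y _ (hD s).ne',
    fun s => norm_geodesicVelocity_div h.y_pos h.v_pos hb hbv hab hk (Real.exp_pos _),
    fun s => hasDerivAt_geodesicVelocity (p := fun s => Real.exp (k * s)) (hasDerivAt_exp_mul k s)
      x h.y_pos.ne' h.v_pos.ne' (Real.exp_pos _).ne' (hD s).ne' hab⟩

lemma contDiff (h : IsExpDist x y u v l) (k : ℝ) (n : WithTop ℕ∞) :
    ContDiff ℝ n (fun s => joinPoint x y u v l (Real.exp (k * s))) := by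
  obtain ⟨hb, hbv, -⟩ := coeff_relations h.y_pos h.v_pos h.one_le h.add_inv
  have hE : ContDiff ℝ n fun s => Real.exp (k * s) := (contDiff_const.mul contDiff_id).exp
  have hE2 : ContDiff ℝ n fun s => Real.exp (k * s) ^ 2 - 1 := (hE.pow 2).sub contDiff_const
  have ofReal : ∀ {f : ℝ → ℝ}, ContDiff ℝ n f → ContDiff ℝ n fun s => (f s : ℂ) :=
    fun hf => Complex.ofRealCLM.contDiff.comp hf
  simp only [joinPoint, geodesicPoint, div_eq_mul_inv]
  exact contDiff_const.add (contDiff_const.mul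
    (((ofReal (contDiff_const.mul hE2)).add
      (contDiff_const.mul (ofReal (contDiff_const.mul hE)))).mul
    ((ofReal ((contDiff_const.mul hE2).add contDiff_const)).inv fun s =>
      Complex.ofReal_ne_zero.2 (geodesic_den_pos h.v_pos hb hbv (Real.exp_pos (k * s))).ne')))

/-- A point that divides the distance of the end points in the ratio `θ : 1 - θ` is the point of
the geodesic with the parameter `l ^ θ`. -/
lemma eq_joinPoint {z w ζ : ℍ} (h : IsExpDist z.re z.im w.re w.im l) {θ : ℝ}
    (h₁ : dist z ζ = θ * Real.log l) (h₂ : dist ζ w = (1 - θ) * Real.log l) :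
    (ζ : ℂ) = joinPoint z.re z.im w.re w.im l (Real.exp (θ * Real.log l)) := by
  have hl : 0 < l := one_pos.trans_le h.one_le
  have c₁ := cosh_dist' z ζ
  have c₂ := cosh_dist' ζ w
  have hz := z.im_pos
  have hw := w.im_pos
  have hζ := ζ.im_pos
  rw [h₁, Real.cosh_eq, Real.exp_neg] at c₁
  rw [h₂, Real.cosh_eq, sub_mul, one_mul, neg_sub, Real.exp_sub, Real.exp_sub, Real.exp_log hl]
    at c₂
  have hp := Real.exp_pos (θ * Real.log l)
  have hp1 : l = 1 → Real.exp (θ * Real.log l) = 1 := by rintro rfl; simp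
  generalize Real.exp (θ * Real.log l) = p at *
  rw [← eq_joinPoint_of_dist_eq (X := ζ.re) (Y := ζ.im) hz hw h.one_le hp h.add_inv ?_ ?_ hp1]
  · apply Complex.ext <;> simp
  · rw [eq_div_iff (by positivity)] at c₁
    linear_combination -c₁
  · rw [eq_div_iff (by positivity)] at c₂
    linear_combination -c₂

end IsExpDist

/-! ### Geodesics of `Ĥ₂` -/

namespace IsHalfPlaneGeodesic

variable {g₁ g₁' g₂ g₂' : ℝ → ℂ} {k₁ k₂ : ℝ}

lemma dot_ofEigen (h₁ : IsHalfPlaneGeodesic g₁ g₁' k₁) (h₂ : IsHalfPlaneGeodesic g₂ g₂' k₂) :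
    dot (fun s => ofEigen (g₁ s) (g₂ s)) = fun s => ofEigen (g₁' s) (g₂' s) := by
  funext s
  exact dot_eq_ofEigen (Filter.Eventually.of_forall fun _ => rfl) (h₁.hasDerivAt s)
    (h₂.hasDerivAt s)

lemma arcLength_ofEigen (h₁ : IsHalfPlaneGeodesic g₁ g₁' k₁)
    (h₂ : IsHalfPlaneGeodesic g₂ g₂' k₂) (a b : ℝ) :
    arcLength (fun s => ofEigen (g₁ s) (g₂ s)) a b = (b - a) * √(k₁ ^ 2 + k₂ ^ 2) := by
  simp only [arcLength, h₁.dot_ofEigen h₂,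
    fun s => metricSq_ofEigen (h₁.im_pos s).ne' (h₂.im_pos s).ne', h₁.speed, h₂.speed]
  simp

lemma dot_dot_ofEigen (h₁ : IsHalfPlaneGeodesic g₁ g₁' k₁)
    (h₂ : IsHalfPlaneGeodesic g₂ g₂' k₂) (s : ℝ) :
    dot (dot fun s => ofEigen (g₁ s) (g₂ s)) s =
      -Complex.I • (dot (fun s => ofEigen (g₁ s) (g₂ s)) s * imInv (ofEigen (g₁ s) (g₂ s)) *
        dot (fun s => ofEigen (g₁ s) (g₂ s)) s) := by
  rw [h₁.dot_ofEigen h₂, imInv_ofEigen (h₁.im_pos s).ne' (h₂.im_pos s).ne', ofEigen_mul,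
    ofEigen_mul, smul_ofEigen]
  exact dot_eq_ofEigen (Filter.Eventually.of_forall fun _ => rfl) (h₁.hasDerivAt_velocity s)
    (h₂.hasDerivAt_velocity s)

end IsHalfPlaneGeodesic

lemma contDiff_ofEigen {g₁ g₂ : ℝ → ℂ} {n : WithTop ℕ∞} (h₁ : ContDiff ℝ n g₁)
    (h₂ : ContDiff ℝ n g₂) (i j : Fin 2) :
    ContDiff ℝ n fun s => ofEigen (g₁ s) (g₂ s) i j := by
  have hadd : ContDiff ℝ n fun s => (g₁ s + g₂ s) / 2 := (h₁.add h₂).div_const 2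
  have hsub : ContDiff ℝ n fun s => (g₁ s - g₂ s) / 2 := (h₁.sub h₂).div_const 2
  fin_cases i <;> fin_cases j
  · exact hadd
  · exact hsub
  · exact hsub
  · exact hadd

lemma PiecewiseC1.of_contDiff {γ : ℝ → Mat2} {a b : ℝ} (hab : a ≤ b)
    (h : ∀ i j, ContDiff ℝ 1 fun u => γ u i j) : PiecewiseC1 γ a b := by
  refine ⟨1, fun k => if k = 0 then a else b, ?_, by simp, by simp,
    fun k _ i j => (h i j).contDiffOn⟩
  intro k m hkm
  by_cases hk : k = 0 <;> by_cases hm : m = 0 <;> simp [hk, hm, hab]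
  omega

/-! ### Equality in the triangle inequality of the product -/

/-- If a vector `a` is at most as long as `ℓ`, a vector `b` at most as long as `σ - ℓ`, and `a + b`
dominates a nonnegative vector `d` of length `σ`, then `a` is the multiple `(ℓ / σ) d`. -/
lemma eq_smul_of_norm_le {a₁ a₂ b₁ b₂ d₁ d₂ ℓ σ : ℝ} (hd₁ : 0 ≤ d₁) (hd₂ : 0 ≤ d₂)
    (h₁ : d₁ ≤ a₁ + b₁) (h₂ : d₂ ≤ a₂ + b₂) (hd : √(d₁ ^ 2 + d₂ ^ 2) = σ)
    (ha : √(a₁ ^ 2 + a₂ ^ 2) ≤ ℓ) (hb : √(b₁ ^ 2 + b₂ ^ 2) ≤ σ - ℓ) :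
    a₁ = ℓ / σ * d₁ ∧ a₂ = ℓ / σ * d₂ := by
  have hℓ : 0 ≤ ℓ := (Real.sqrt_nonneg _).trans ha
  have hσℓ : 0 ≤ σ - ℓ := (Real.sqrt_nonneg _).trans hb
  have hσ : 0 ≤ σ := by linarith
  rw [Real.sqrt_le_left hℓ] at ha
  rw [Real.sqrt_le_left hσℓ] at hb
  rw [Real.sqrt_eq_iff_eq_sq (by positivity) hσ] at hd
  rcases hσ.eq_or_lt with rfl | hpos
  · have hℓ0 : ℓ = 0 := by linarith
    subst hℓ0
    constructor <;> nlinarith [sq_nonneg a₁, sq_nonneg a₂]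
  have hdb : d₁ * b₁ + d₂ * b₂ ≤ σ * (σ - ℓ) := by
    refine (abs_le_of_sq_le_sq' ?_ (by positivity)).2
    calc (d₁ * b₁ + d₂ * b₂) ^ 2 ≤ (d₁ ^ 2 + d₂ ^ 2) * (b₁ ^ 2 + b₂ ^ 2) := by
          nlinarith [sq_nonneg (d₁ * b₂ - d₂ * b₁)]
      _ ≤ (σ * (σ - ℓ)) ^ 2 := by
          rw [hd, mul_pow]
          gcongr
  have hda : σ * ℓ ≤ d₁ * a₁ + d₂ * a₂ := by
    nlinarith [mul_le_mul_of_nonneg_left h₁ hd₁, mul_le_mul_of_nonneg_left h₂ hd₂]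
  have hzero : (σ * a₁ - ℓ * d₁) ^ 2 + (σ * a₂ - ℓ * d₂) ^ 2 ≤ 0 := by
    have e₁ := mul_le_mul_of_nonneg_left ha (sq_nonneg σ)
    have e₂ := mul_le_mul_of_nonneg_left hda (mul_nonneg hσ hℓ)
    have e₃ : ℓ ^ 2 * (d₁ ^ 2 + d₂ ^ 2) = ℓ ^ 2 * σ ^ 2 := by rw [hd]
    nlinarith
  have z₁ : σ * a₁ - ℓ * d₁ = 0 := (pow_eq_zero_iff two_ne_zero).1 <|
    le_antisymm (by linarith [sq_nonneg (σ * a₂ - ℓ * d₂)]) (sq_nonneg _)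
  have z₂ : σ * a₂ - ℓ * d₂ = 0 := (pow_eq_zero_iff two_ne_zero).1 <|
    le_antisymm (by linarith [sq_nonneg (σ * a₁ - ℓ * d₁)]) (sq_nonneg _)
  constructor
  · field_simp
    linarith
  · field_simp
    linarith

/-- A point between two points of a product of hyperbolic planes divides both component distances
in the same ratio. -/
lemma dist_components_of_between {P R S : WithLp 2 (ℍ × ℍ)} {ℓ σ : ℝ} (hσ : dist P S = σ)
    (h₁ : dist P R ≤ ℓ) (h₂ : dist R S ≤ σ - ℓ) :
    (dist P.fst R.fst = ℓ / σ * dist P.fst S.fst ∧ dist P.snd R.snd = ℓ / σ * dist P.snd S.snd) ∧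
    (dist R.fst S.fst = (σ - ℓ) / σ * dist P.fst S.fst ∧
      dist R.snd S.snd = (σ - ℓ) / σ * dist P.snd S.snd) := by
  rw [dist_planes] at hσ h₁ h₂
  refine ⟨eq_smul_of_norm_le dist_nonneg dist_nonneg (dist_triangle _ _ _) (dist_triangle _ _ _)
    hσ h₁ h₂, eq_smul_of_norm_le dist_nonneg dist_nonneg ?_ ?_ hσ h₂ (by simpa using h₁)⟩
  · rw [add_comm]; exact dist_triangle _ _ _
  · rw [add_comm]; exact dist_triangle _ _ _

/-! ### Distance and shortest curves in `Ĥ₂` -/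

variable {x₁ y₁ u₁ v₁ l₁ x₂ y₂ u₂ v₂ l₂ : ℝ}

/-- The distance of two points of `Ĥ₂` in the Euclidean product of the hyperbolic planes. -/
lemma dist_toPlanes (h₁ : IsExpDist x₁ y₁ u₁ v₁ l₁) (h₂ : IsExpDist x₂ y₂ u₂ v₂ l₂) :
    dist (toPlanes (ofEigen (x₁ + Complex.I * y₁) (x₂ + Complex.I * y₂)))
      (toPlanes (ofEigen (u₁ + Complex.I * v₁) (u₂ + Complex.I * v₂))) =
      √(Real.log l₁ ^ 2 + Real.log l₂ ^ 2) := by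
  have key : ∀ {x y u v l : ℝ}, IsExpDist x y u v l →
      dist (ofComplex (x + Complex.I * y)) (ofComplex (u + Complex.I * v)) = Real.log l := by
    intro x y u v l h
    have hy : 0 < (x + Complex.I * y : ℂ).im := by simpa using h.y_pos
    have hv : 0 < (u + Complex.I * v : ℂ).im := by simpa using h.v_pos
    rw [ofComplex_apply_of_im_pos hy, ofComplex_apply_of_im_pos hv]
    apply dist_eq_log h.one_le
    simpa [UpperHalfPlane.im, UpperHalfPlane.re] using h.add_inv
  rw [dist_planes, ← key h₁, ← key h₂]
  simp [toPlanes]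

/-- The curve in `Ĥ₂` whose eigenvalues run from `x₁ + i y₁` to `u₁ + i v₁` and from `x₂ + i y₂` to
`u₂ + i v₂` along hyperbolic geodesics, with constant speeds such that both arrive at the parameter
`√(log² l₁ + log² l₂)`. -/
def joinCurve (x₁ y₁ u₁ v₁ l₁ x₂ y₂ u₂ v₂ l₂ : ℝ) (s : ℝ) : Mat2 :=
  ofEigen
    (joinPoint x₁ y₁ u₁ v₁ l₁
      (Real.exp (Real.log l₁ / √(Real.log l₁ ^ 2 + Real.log l₂ ^ 2) * s)))
    (joinPoint x₂ y₂ u₂ v₂ l₂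
      (Real.exp (Real.log l₂ / √(Real.log l₁ ^ 2 + Real.log l₂ ^ 2) * s)))

lemma contDiff_joinCurve (h₁ : IsExpDist x₁ y₁ u₁ v₁ l₁) (h₂ : IsExpDist x₂ y₂ u₂ v₂ l₂)
    (n : WithTop ℕ∞) (i j : Fin 2) :
    ContDiff ℝ n fun s => joinCurve x₁ y₁ u₁ v₁ l₁ x₂ y₂ u₂ v₂ l₂ s i j :=
  contDiff_ofEigen (h₁.contDiff _ n) (h₂.contDiff _ n) i j

lemma joins_joinCurve (h₁ : IsExpDist x₁ y₁ u₁ v₁ l₁) (h₂ : IsExpDist x₂ y₂ u₂ v₂ l₂) :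
    Joins (joinCurve x₁ y₁ u₁ v₁ l₁ x₂ y₂ u₂ v₂ l₂) 0 (√(Real.log l₁ ^ 2 + Real.log l₂ ^ 2))
      (ofEigen (x₁ + Complex.I * y₁) (x₂ + Complex.I * y₂))
      (ofEigen (u₁ + Complex.I * v₁) (u₂ + Complex.I * v₂)) := by
  have hL₁ := Real.log_nonneg h₁.one_le
  have hL₂ := Real.log_nonneg h₂.one_le
  have hexp : ∀ {x y u v l : ℝ}, IsExpDist x y u v l →
      Real.log l ^ 2 ≤ Real.log l₁ ^ 2 + Real.log l₂ ^ 2 →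
      Real.exp (Real.log l / √(Real.log l₁ ^ 2 + Real.log l₂ ^ 2) *
        √(Real.log l₁ ^ 2 + Real.log l₂ ^ 2)) = l := by
    intro x y u v l h hle
    have hl : 0 < l := one_pos.trans_le h.one_le
    -- if the distance vanishes, then so does `log l`
    rw [div_mul_cancel_of_imp, Real.exp_log hl]
    intro h0
    rw [Real.sqrt_eq_zero (by positivity)] at h0
    exact (pow_eq_zero_iff two_ne_zero).1 (le_antisymm (hle.trans_eq h0) (sq_nonneg _))
  refine ⟨Real.sqrt_nonneg _, fun t _ => ?_,
    PiecewiseC1.of_contDiff (Real.sqrt_nonneg _) (contDiff_joinCurve h₁ h₂ 1), ?_, ?_⟩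
  · exact ofEigen_mem_hatH2.2
      ⟨(h₁.isHalfPlaneGeodesic (div_nonneg hL₁ (Real.sqrt_nonneg _))).im_pos t,
        (h₂.isHalfPlaneGeodesic (div_nonneg hL₂ (Real.sqrt_nonneg _))).im_pos t⟩
  · simp only [joinCurve, mul_zero, Real.exp_zero]
    rw [joinPoint_one _ _ _ _ h₁.v_pos.ne', joinPoint_one _ _ _ _ h₂.v_pos.ne']
  · rw [joinCurve, hexp h₁ (by linarith [sq_nonneg (Real.log l₂)]),
      hexp h₂ (by linarith [sq_nonneg (Real.log l₁)]),
      joinPoint_self h₁.y_pos h₁.v_pos h₁.one_le h₁.add_inv,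
      joinPoint_self h₂.y_pos h₂.v_pos h₂.one_le h₂.add_inv]

lemma arcLength_joinCurve (h₁ : IsExpDist x₁ y₁ u₁ v₁ l₁) (h₂ : IsExpDist x₂ y₂ u₂ v₂ l₂)
    {s : ℝ} (hs : s ∈ Icc 0 (√(Real.log l₁ ^ 2 + Real.log l₂ ^ 2))) :
    arcLength (joinCurve x₁ y₁ u₁ v₁ l₁ x₂ y₂ u₂ v₂ l₂) 0 s = s := by
  have hL₁ := Real.log_nonneg h₁.one_le
  have hL₂ := Real.log_nonneg h₂.one_le
  have hσ := Real.sqrt_nonneg (Real.log l₁ ^ 2 + Real.log l₂ ^ 2)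
  rcases hσ.eq_or_lt with h0 | hpos
  · rw [← h0] at hs
    obtain rfl : s = 0 := le_antisymm hs.2 hs.1
    simp [arcLength]
  refine ((h₁.isHalfPlaneGeodesic (div_nonneg hL₁ hσ)).arcLength_ofEigen
    (h₂.isHalfPlaneGeodesic (div_nonneg hL₂ hσ)) 0 s).trans ?_
  have hsq := Real.sq_sqrt (show 0 ≤ Real.log l₁ ^ 2 + Real.log l₂ ^ 2 by positivity)
  rw [div_pow, div_pow, ← add_div, hsq, div_self (by rw [← hsq]; positivity)]
  simp

lemma dot_dot_joinCurve (h₁ : IsExpDist x₁ y₁ u₁ v₁ l₁) (h₂ : IsExpDist x₂ y₂ u₂ v₂ l₂) (s : ℝ) :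
    dot (dot (joinCurve x₁ y₁ u₁ v₁ l₁ x₂ y₂ u₂ v₂ l₂)) s =
      -Complex.I • (dot (joinCurve x₁ y₁ u₁ v₁ l₁ x₂ y₂ u₂ v₂ l₂) s *
        imInv (joinCurve x₁ y₁ u₁ v₁ l₁ x₂ y₂ u₂ v₂ l₂ s) *
        dot (joinCurve x₁ y₁ u₁ v₁ l₁ x₂ y₂ u₂ v₂ l₂) s) :=
  (h₁.isHalfPlaneGeodesic (div_nonneg (Real.log_nonneg h₁.one_le)
    (Real.sqrt_nonneg _))).dot_dot_ofEigen
    (h₂.isHalfPlaneGeodesic (div_nonneg (Real.log_nonneg h₂.one_le) (Real.sqrt_nonneg _))) s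

/-- Every curve in `Ĥ₂` is at least as long as `√(log² l₁ + log² l₂)`. -/
lemma Joins.sqrt_le_arcLength (h₁ : IsExpDist x₁ y₁ u₁ v₁ l₁) (h₂ : IsExpDist x₂ y₂ u₂ v₂ l₂)
    {γ : ℝ → Mat2} {a b : ℝ}
    (hγ : Joins γ a b (ofEigen (x₁ + Complex.I * y₁) (x₂ + Complex.I * y₂))
      (ofEigen (u₁ + Complex.I * v₁) (u₂ + Complex.I * v₂))) :
    √(Real.log l₁ ^ 2 + Real.log l₂ ^ 2) ≤ arcLength γ a b := by
  have h := (hγ.dist_le_arcLength (right_mem_Icc.2 hγ.le)).1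
  rwa [hγ.right, dist_toPlanes h₁ h₂] at h

lemma isGeodesic_joinCurve (h₁ : IsExpDist x₁ y₁ u₁ v₁ l₁) (h₂ : IsExpDist x₂ y₂ u₂ v₂ l₂) :
    IsGeodesic (joinCurve x₁ y₁ u₁ v₁ l₁ x₂ y₂ u₂ v₂ l₂) 0 (√(Real.log l₁ ^ 2 + Real.log l₂ ^ 2))
      (ofEigen (x₁ + Complex.I * y₁) (x₂ + Complex.I * y₂))
      (ofEigen (u₁ + Complex.I * v₁) (u₂ + Complex.I * v₂)) := by
  refine ⟨joins_joinCurve h₁ h₂, fun γ a b hγ => ?_⟩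
  rw [arcLength_joinCurve h₁ h₂ ⟨Real.sqrt_nonneg _, le_rfl⟩]
  exact hγ.sqrt_le_arcLength h₁ h₂

lemma sympDist_eq (h₁ : IsExpDist x₁ y₁ u₁ v₁ l₁) (h₂ : IsExpDist x₂ y₂ u₂ v₂ l₂) :
    sympDist (ofEigen (x₁ + Complex.I * y₁) (x₂ + Complex.I * y₂))
      (ofEigen (u₁ + Complex.I * v₁) (u₂ + Complex.I * v₂)) =
      √(Real.log l₁ ^ 2 + Real.log l₂ ^ 2) := by
  refine IsLeast.csInf_eq ⟨⟨_, _, _, joins_joinCurve h₁ h₂,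
    arcLength_joinCurve h₁ h₂ ⟨Real.sqrt_nonneg _, le_rfl⟩⟩, ?_⟩
  rintro L ⟨γ, a, b, hγ, rfl⟩
  exact hγ.sqrt_le_arcLength h₁ h₂

/-- The points of a shortest curve lie between its end points for the distance of the product, which
determines them. -/
lemma IsGeodesic.eq_joinCurve (h₁ : IsExpDist x₁ y₁ u₁ v₁ l₁) (h₂ : IsExpDist x₂ y₂ u₂ v₂ l₂)
    {γ : ℝ → Mat2} {a b : ℝ}
    (hγ : IsGeodesic γ a b (ofEigen (x₁ + Complex.I * y₁) (x₂ + Complex.I * y₂))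
      (ofEigen (u₁ + Complex.I * v₁) (u₂ + Complex.I * v₂))) {t : ℝ} (ht : t ∈ Icc a b) :
    γ t = joinCurve x₁ y₁ u₁ v₁ l₁ x₂ y₂ u₂ v₂ l₂ (arcLength γ a t) := by
  obtain ⟨hle₁, hle₂, hadd⟩ := hγ.1.dist_le_arcLength ht
  have hlen : arcLength γ a b = √(Real.log l₁ ^ 2 + Real.log l₂ ^ 2) := by
    refine le_antisymm ?_ (hγ.1.sqrt_le_arcLength h₁ h₂)
    have := hγ.2 _ _ _ (joins_joinCurve h₁ h₂)
    rwa [arcLength_joinCurve h₁ h₂ ⟨Real.sqrt_nonneg _, le_rfl⟩] at this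
  rw [hlen] at hadd
  set σ := √(Real.log l₁ ^ 2 + Real.log l₂ ^ 2) with hσ
  set ℓ := arcLength γ a t
  obtain ⟨⟨a₁, a₂⟩, b₁, b₂⟩ := dist_components_of_between (dist_toPlanes h₁ h₂) hle₁
    (hle₂.trans_eq (eq_sub_of_add_eq' hadd))
  have hpos := eigen_im_pos (hγ.1.mem t ht)
  have key : ∀ {x y u v l : ℝ} {ζ : ℂ}, IsExpDist x y u v l → 0 < ζ.im →
      dist (ofComplex (x + Complex.I * y)) (ofComplex ζ) =
        ℓ / σ * dist (ofComplex (x + Complex.I * y)) (ofComplex (u + Complex.I * v)) →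
      dist (ofComplex ζ) (ofComplex (u + Complex.I * v)) =
        (σ - ℓ) / σ * dist (ofComplex (x + Complex.I * y)) (ofComplex (u + Complex.I * v)) →
      (σ = 0 → Real.log l = 0) →
      ζ = joinPoint x y u v l (Real.exp (Real.log l / σ * ℓ)) := by
    intro x y u v l ζ h hζ ha hb h0
    have hy : 0 < (x + Complex.I * y : ℂ).im := by simpa using h.y_pos
    have hv : 0 < (u + Complex.I * v : ℂ).im := by simpa using h.v_pos
    have hd : dist (⟨_, hy⟩ : ℍ) ⟨_, hv⟩ = Real.log l := by
      apply dist_eq_log h.one_le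
      simpa [UpperHalfPlane.im, UpperHalfPlane.re] using h.add_inv
    rw [ofComplex_apply_of_im_pos hy, ofComplex_apply_of_im_pos hv, hd] at ha hb
    rw [ofComplex_apply_of_im_pos hζ] at ha hb
    have h' : IsExpDist (⟨_, hy⟩ : ℍ).re (⟨_, hy⟩ : ℍ).im (⟨_, hv⟩ : ℍ).re (⟨_, hv⟩ : ℍ).im l := by
      simpa [UpperHalfPlane.im, UpperHalfPlane.re] using h
    have hb' : dist (⟨ζ, hζ⟩ : ℍ) ⟨_, hv⟩ = (1 - ℓ / σ) * Real.log l := by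
      rw [hb]
      rcases eq_or_ne σ 0 with hσ0 | hσ0
      · simp [h0 hσ0]
      · rw [sub_div, div_self hσ0]
    have := h'.eq_joinPoint ha hb'
    rw [show Real.log l / σ * ℓ = ℓ / σ * Real.log l by ring]
    simpa [UpperHalfPlane.im, UpperHalfPlane.re] using this
  have hσ0 : σ = 0 → Real.log l₁ ^ 2 + Real.log l₂ ^ 2 = 0 :=
    (Real.sqrt_eq_zero (by positivity)).1
  rw [eq_ofEigen_of_mem (hγ.1.mem t ht), joinCurve, ← hσ]
  congr 1
  · refine key h₁ hpos.1 (by simpa [toPlanes] using a₁) (by simpa [toPlanes] using b₁) fun h => ?_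
    nlinarith [hσ0 h, sq_nonneg (Real.log l₂), sq_nonneg (Real.log l₁)]
  · refine key h₂ hpos.2 (by simpa [toPlanes] using a₂) (by simpa [toPlanes] using b₂) fun h => ?_
    nlinarith [hσ0 h, sq_nonneg (Real.log l₂), sq_nonneg (Real.log l₁)]

end SiegelHat

end

theorem theorem8
    (τ₁ z₁ τ₂ z₂ : ℂ) (Z₁ Z₂ : SiegelHat.Mat2)
    (hZ₁ : Z₁ = !![τ₁, z₁; z₁, τ₁]) (hZ₂ : Z₂ = !![τ₂, z₂; z₂, τ₂])
    (hZ₁mem : Z₁ ∈ SiegelHat.hatH2) (hZ₂mem : Z₂ ∈ SiegelHat.hatH2)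
    (x₁ y₁ x₂ y₂ u₁ v₁ u₂ v₂ : ℝ)
    (h₁ : τ₁ + z₁ = x₁ + Complex.I * y₁) (h₂ : τ₁ - z₁ = x₂ + Complex.I * y₂)
    (h₃ : τ₂ + z₂ = u₁ + Complex.I * v₁) (h₄ : τ₂ - z₂ = u₂ + Complex.I * v₂)
    (A B l l' : ℝ)
    (hA : A = (y₁ ^ 2 + v₁ ^ 2 + (x₁ - u₁) ^ 2) / (y₁ * v₁))
    (hB : B = (y₂ ^ 2 + v₂ ^ 2 + (x₂ - u₂) ^ 2) / (y₂ * v₂))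
    (hl : l = (A + Real.sqrt (A ^ 2 - 4)) / 2)
    (hl' : l' = (B + Real.sqrt (B ^ 2 - 4)) / 2)
    (s₀ : ℝ) (hs₀ : s₀ = SiegelHat.sympDist Z₁ Z₂)
    -- numerators and denominators of the two fractions in the formulas
    (N N' : ℝ → ℂ) (D D' : ℝ → ℝ)
    (hN : ∀ s, N s = ((l * (u₁ - x₁) * (l ^ (2 * s / s₀) - 1) * SiegelHat.c l : ℝ) : ℂ)
      + Complex.I * ((v₁ * l ^ (s / s₀) : ℝ) : ℂ))
    (hD : ∀ s, D s = (l * y₁ - v₁) * (l ^ (2 * s / s₀) - 1) * SiegelHat.c l + v₁)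
    (hN' : ∀ s, N' s = ((l' * (u₂ - x₂) * (l' ^ (2 * s / s₀) - 1) * SiegelHat.c l' : ℝ) : ℂ)
      + Complex.I * ((v₂ * l' ^ (s / s₀) : ℝ) : ℂ))
    (hD' : ∀ s, D' s = (l' * y₂ - v₂) * (l' ^ (2 * s / s₀) - 1) * SiegelHat.c l' + v₂)
    (τ z : ℝ → ℂ) (W : ℝ → SiegelHat.Mat2)
    (hτ : ∀ s, τ s = (x₁ + x₂) / 2 + y₁ / 2 * (N s / D s) + y₂ / 2 * (N' s / D' s))
    (hz : ∀ s, z s = (x₁ - x₂) / 2 + y₁ / 2 * (N s / D s) - y₂ / 2 * (N' s / D' s))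
    (hW : ∀ s, W s = !![τ s, z s; z s, τ s]) :
    -- the auxiliary quantities are in the asserted ranges, and the formulas are meaningful
    2 ≤ A ∧ 2 ≤ B ∧ 1 ≤ l ∧ 1 ≤ l' ∧
    (∀ s ∈ Icc (0 : ℝ) s₀, 0 < D s ∧ 0 < D' s) ∧
    -- the value of the total length
    s₀ = Real.sqrt (Real.log l ^ 2 + Real.log l' ^ 2) ∧
    -- `W` on `[0, s₀]` is a smooth geodesic from `Z₁` to `Z₂`
    (∀ i j, ContDiffOn ℝ (⊤ : ℕ∞) (fun s => W s i j) (Icc 0 s₀)) ∧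
    SiegelHat.IsGeodesic W 0 s₀ Z₁ Z₂ ∧
    -- the parameter `s` is the length of the arc from `Z₁`
    (∀ s ∈ Icc (0 : ℝ) s₀, SiegelHat.arcLength W 0 s = s) ∧
    -- the geodesic equation
    (∀ s ∈ Ioo (0 : ℝ) s₀, SiegelHat.dot (SiegelHat.dot W) s =
      -Complex.I • (SiegelHat.dot W s * SiegelHat.imInv (W s) * SiegelHat.dot W s)) ∧
    -- uniqueness: any geodesic from `Z₁` to `Z₂`, however parametrized, is `W` once it is
    -- referred to its arc length
    (∀ (γ : ℝ → SiegelHat.Mat2) (a b : ℝ), SiegelHat.IsGeodesic γ a b Z₁ Z₂ →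
      ∀ t ∈ Icc a b, γ t = W (SiegelHat.arcLength γ a t)) := by
  have e₁ : Z₁ = SiegelHat.ofEigen (x₁ + Complex.I * y₁) (x₂ + Complex.I * y₂) := by
    rw [hZ₁, SiegelHat.eq_ofEigen, h₁, h₂]
  have e₂ : Z₂ = SiegelHat.ofEigen (u₁ + Complex.I * v₁) (u₂ + Complex.I * v₂) := by
    rw [hZ₂, SiegelHat.eq_ofEigen, h₃, h₄]
  rw [e₁, SiegelHat.ofEigen_mem_hatH2] at hZ₁mem
  rw [e₂, SiegelHat.ofEigen_mem_hatH2] at hZ₂mem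
  obtain ⟨hy₁, hy₂⟩ : 0 < y₁ ∧ 0 < y₂ := by simpa using hZ₁mem
  obtain ⟨hv₁, hv₂⟩ : 0 < v₁ ∧ 0 < v₂ := by simpa using hZ₂mem
  have hA2 := SiegelHat.two_le_of_eq hy₁ hv₁ hA
  have hB2 := SiegelHat.two_le_of_eq hy₂ hv₂ hB
  obtain ⟨hl1, hlA⟩ := SiegelHat.one_le_and_add_inv_eq hA2 hl
  obtain ⟨hl1', hlB⟩ := SiegelHat.one_le_and_add_inv_eq hB2 hl'
  have E₁ : SiegelHat.IsExpDist x₁ y₁ u₁ v₁ l := ⟨hy₁, hv₁, hl1, hlA.trans hA⟩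
  have E₂ : SiegelHat.IsExpDist x₂ y₂ u₂ v₂ l' := ⟨hy₂, hv₂, hl1', hlB.trans hB⟩
  have hσ : s₀ = Real.sqrt (Real.log l ^ 2 + Real.log l' ^ 2) := by
    rw [hs₀, e₁, e₂, SiegelHat.sympDist_eq E₁ E₂]
  -- the powers of `m = l, l'` in the formulas, where `0 / 0 = 0` if `s₀ = 0`
  have hpow : ∀ {m : ℝ}, 1 ≤ m → ∀ s : ℝ,
      m ^ (s / s₀) = Real.exp (Real.log m / s₀ * s) ∧
        m ^ (2 * s / s₀) = Real.exp (Real.log m / s₀ * s) ^ 2 := by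
    intro m hm s
    have hm0 : 0 < m := one_pos.trans_le hm
    constructor
    · rw [Real.rpow_def_of_pos hm0]
      congr 1
      ring
    · rw [Real.rpow_def_of_pos hm0, ← Real.exp_nat_mul]
      congr 1
      push_cast
      ring
  have hden : ∀ {x y u v m : ℝ}, SiegelHat.IsExpDist x y u v m → ∀ s : ℝ,
      0 < (m * y - v) * (m ^ (2 * s / s₀) - 1) * SiegelHat.c m + v := by
    intro x y u v m h s
    obtain ⟨hb, hbv, -⟩ := SiegelHat.coeff_relations h.y_pos h.v_pos h.one_le h.add_inv
    rw [(hpow h.one_le s).2, mul_right_comm]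
    exact SiegelHat.geodesic_den_pos h.v_pos hb hbv (Real.exp_pos _)
  have hjoin : ∀ {x y u v m : ℝ}, 1 ≤ m → ∀ s : ℝ,
      SiegelHat.joinPoint x y u v m (Real.exp (Real.log m / s₀ * s)) =
        x + y * ((((m * (u - x) * (m ^ (2 * s / s₀) - 1) * SiegelHat.c m : ℝ) : ℂ)
          + Complex.I * ((v * m ^ (s / s₀) : ℝ) : ℂ)) /
          (((m * y - v) * (m ^ (2 * s / s₀) - 1) * SiegelHat.c m + v : ℝ) : ℂ)) := by
    intro x y u v m hm s
    rw [(hpow hm s).1, (hpow hm s).2, SiegelHat.joinPoint, SiegelHat.geodesicPoint,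
      mul_right_comm (m * (u - x)), mul_right_comm (m * y - v)]
  have hWeq : W = SiegelHat.joinCurve x₁ y₁ u₁ v₁ l x₂ y₂ u₂ v₂ l' := by
    funext s
    rw [hW, SiegelHat.eq_ofEigen, SiegelHat.joinCurve, ← hσ, hjoin hl1, hjoin hl1', ← hN, ← hN',
      ← hD, ← hD', hτ, hz]
    congr 1 <;> ring
  subst hWeq
  rw [e₁, e₂, hσ]
  refine ⟨hA2, hB2, hl1, hl1', fun s _ => ?_, rfl,
    fun i j => (SiegelHat.contDiff_joinCurve E₁ E₂ _ i j).contDiffOn,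
    SiegelHat.isGeodesic_joinCurve E₁ E₂, fun s hs => SiegelHat.arcLength_joinCurve E₁ E₂ hs,
    fun s _ => SiegelHat.dot_dot_joinCurve E₁ E₂ s,
    fun γ a b hγ t ht => hγ.eq_joinCurve E₁ E₂ ht⟩
  rw [hD, hD']
  exact ⟨hden E₁ s, hden E₂ s⟩
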